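/- Conventions. For a unital commutative $C^*$-algebra $A$, a Hilbert $A$-module is a right $A$-module $X$ with an $A$-valued inner product $\langle\cdot,\cdot\rangle_A$ that is $\mathbb C$-linear and $A$-linear in the second variable, satisfies $\langle y,x\rangle_A=\langle x,y\rangle_A^*$ and $\langle x,x\rangle_A\ge 0$ with equality only for $x=0$, and such that $X$ is complete for the norm $\|x\|=\|\langle x,x\rangle_A\|^{1/2}$. Isomorphisms ($\cong$) of Hilbert $A$-modules are $A$-module isomorphisms preserving the $A$-valued inner products. For a set $J$, $\bigoplus_{j\in J}A$ denotes the Hilbert $A$-module of families $(a_j)_{j\in J}$ in $A$ for which $\sum_j a_j^*a_j$ converges in norm, with $\langle (a_j),(b_j)\rangle_A=\sum_j a_j^*b_j$. A family $(x_j)_{j\in J}$ in $X$ is a frame of $X$ if there is a real constant $C>0$ such that for every $x\in X$ the sum $\sum_{j\in J}\langle x,x_j\rangle_A\langle x_j,x\rangle_A$ converges in the ultraweak operator topology to an element of the universal enveloping von Neumann algebra $A^{**}$ of $A$ and $$C\langle x,x\rangle_A\le\sum_{j\in J}\langle x,x_j\rangle_A\langle x_j,x\rangle_A\le C^{-1}\langle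 x,x\rangle_A .$$ It is a standard frame if moreover these sums converge in norm for every $x\in X$. Theorem. Let $A$ be a unital commutative $C^*$-algebra. The following are equivalent: (1) $A$ is finite-dimensional; (2) for every Hilbert $A$-module $X$ there is a set $J$ such that $X\oplus\bigl(\bigoplus_{j\in J}A\bigr)\cong\bigoplus_{j\in J}A$; (3) for every Hilbert $A$-module $X$ there are a set $J$ and a Hilbert $A$-module $Y$ such that $X\oplus Y\cong\bigoplus_{j\in J}A$; (4) every Hilbert $A$-module has a standard frame; (5) every Hilbert $A$-module has a frame. In particular, if $A$ is infinite-dimensional, then there is a Hilbert $A$-module $X$ that has no frame and for which $X\oplus\bigl(\bigoplus_{j\in J}A\bigr)\not\cong\bigoplus_{j\in J}A$ for every set $J$. -/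

import Mathlib

open scoped ComplexOrder InnerProductSpace WithCStarModule ENNReal

universe u

/-!
## Hilbert modules

A Hilbert `A`-module is a complete `CStarModule A X`.  All algebras below are commutative, so left
and right modules coincide and `a • x` is the element written `x a` for a right module.
-/

/-- Two Hilbert `A`-modules are isomorphic if there is an `A`-module isomorphism between them that
preserves the `A`-valued inner products. -/
def HilbertModuleIso (A : Type*) [CommCStarAlgebra A] [PartialOrder A]
    (X Y : Type*) [NormedAddCommGroup X] [NormedSpace ℂ X] [Module A X] [CStarModule A X]
    [NormedAddCommGroup Y] [NormedSpace ℂ Y] [Module A Y] [CStarModule A Y] : Prop :=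
  ∃ e : X ≃ₗ[A] Y, ∀ x y : X, inner A (e x) (e y) = inner A x y

section StandardModule

variable {A : Type*} [CommCStarAlgebra A] [PartialOrder A] [StarOrderedRing A] {J : Type*}

theorem norm_sum_star_mul_sq_le (f g : J → A) (s : Finset J) :
    ‖∑ j ∈ s, star (f j) * g j‖ ^ 2 ≤
      ‖∑ j ∈ s, star (f j) * f j‖ * ‖∑ j ∈ s, star (g j) * g j‖ := by
  let F : C⋆ᵐᵒᵈ(A, s → A) := (WithCStarModule.equiv A (s → A)).symm fun j => f j
  let G : C⋆ᵐᵒᵈ(A, s → A) := (WithCStarModule.equiv A (s → A)).symm fun j => g j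
  have key (a b : J → A) :
      inner A ((WithCStarModule.equiv A (s → A)).symm fun j : s => a j)
        ((WithCStarModule.equiv A (s → A)).symm fun j : s => b j) =
      ∑ j ∈ s, star (a j) * b j := by
    rw [WithCStarModule.pi_inner, ← Finset.sum_coe_sort s]
    exact Finset.sum_congr rfl fun j _ => mul_comm _ _
  have h := CStarModule.norm_inner_le (A := A) C⋆ᵐᵒᵈ(A, s → A) (x := F) (y := G)
  rw [← key f g, ← key f f, ← key g g, ← CStarModule.norm_sq_eq A, ← CStarModule.norm_sq_eq A,
    ← mul_pow]
  exact pow_le_pow_left₀ (norm_nonneg _) h 2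

theorem summable_star_mul {f g : J → A} (hf : Summable fun j => star (f j) * f j)
    (hg : Summable fun j => star (g j) * g j) : Summable fun j => star (f j) * g j := by
  rw [summable_iff_vanishing_norm] at hf hg ⊢
  intro ε hε
  obtain ⟨s, hs⟩ := hf ε hε
  obtain ⟨t, ht⟩ := hg ε hε
  classical
  refine ⟨s ∪ t, fun r hr => ?_⟩
  have h1 := hs r (Finset.disjoint_of_subset_right Finset.subset_union_left hr)
  have h2 := ht r (Finset.disjoint_of_subset_right Finset.subset_union_right hr)
  have h3 := norm_sum_star_mul_sq_le f g r
  refine lt_of_pow_lt_pow_left₀ 2 hε.le (h3.trans_lt ?_)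
  rw [sq]
  exact mul_lt_mul'' h1 h2 (norm_nonneg _) (norm_nonneg _)

variable (A J)

/-- The families `(a_j)` in `A` such that `∑ a_j* a_j` converges in norm. -/
def standardSubmodule : Submodule A (J → A) where
  carrier := {f | Summable fun j => star (f j) * f j}
  zero_mem' := by simp
  add_mem' {f g} hf hg := by
    have h := ((hf.add (summable_star_mul hf hg)).add (summable_star_mul hg hf)).add hg
    refine h.congr fun j => ?_
    simp only [Pi.add_apply, star_add]
    ring
  smul_mem' a f hf := by
    have h := hf.mul_left (star a * a)
    refine h.congr fun j => ?_
    simp only [Pi.smul_apply, smul_eq_mul, star_mul]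
    ring

/-- The direct sum `⊕_{j ∈ J} A` of copies of the Hilbert `A`-module `A`. -/
def StandardModule : Type _ := standardSubmodule A J

namespace StandardModule

noncomputable instance : AddCommGroup (StandardModule A J) :=
  inferInstanceAs (AddCommGroup (standardSubmodule A J))

noncomputable instance : Module A (StandardModule A J) :=
  inferInstanceAs (Module A (standardSubmodule A J))

noncomputable instance : Module ℂ (StandardModule A J) :=
  inferInstanceAs (Module ℂ (standardSubmodule A J))

instance : CoeFun (StandardModule A J) fun _ => J → A := ⟨Subtype.val⟩

variable {A J}

@[simp] theorem add_apply (f g : StandardModule A J) (j : J) : (f + g) j = f j + g j := rfl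

@[simp] theorem smul_apply (a : A) (f : StandardModule A J) (j : J) : (a • f) j = a * f j := rfl

@[simp] theorem complex_smul_apply (c : ℂ) (f : StandardModule A J) (j : J) :
    (c • f) j = c • f j := rfl

theorem summable_inner (f g : StandardModule A J) : Summable fun j => star (f j) * g j :=
  summable_star_mul f.2 g.2

noncomputable instance : Norm (StandardModule A J) where
  norm f := √‖∑' j, star (f j) * f j‖

/-- The inner product `⟨f, g⟩ = ∑ f_j* g_j`, a norm convergent sum. -/
noncomputable instance : CStarModule A (StandardModule A J) where
  inner f g := ∑' j, star (f j) * g j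
  inner_add_right {f g h} := by
    rw [← (summable_inner f g).tsum_add (summable_inner f h)]
    exact tsum_congr fun j => mul_add _ _ _
  inner_self_nonneg {f} := tsum_nonneg fun j => star_mul_self_nonneg _
  inner_self {f} := by
    refine ⟨fun h => ?_, fun h => ?_⟩
    · have h' := (hasSum_zero_iff_of_nonneg (fun j => star_mul_self_nonneg (f j))).1
        (h ▸ (summable_inner f f).hasSum)
      refine Subtype.ext (funext fun j => ?_)
      exact CStarRing.star_mul_self_eq_zero_iff (f j) |>.1 (congrFun h' j)
    · subst h
      have : ∀ j, (0 : StandardModule A J) j = 0 := fun j => rfl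
      simp [this]
  inner_op_smul_right {a f g} := by
    rw [← (summable_inner f g).tsum_mul_left]
    exact tsum_congr fun j => mul_left_comm _ _ _
  inner_smul_right_complex {c f g} := by
    rw [← (summable_inner f g).tsum_const_smul]
    exact tsum_congr fun j => mul_smul_comm _ _ _
  star_inner f g := by
    rw [tsum_star]
    exact tsum_congr fun j => by rw [star_mul, star_star]
  norm_eq_sqrt_norm_inner_self f := rfl

noncomputable instance : NormedAddCommGroup (StandardModule A J) :=
  NormedAddCommGroup.ofCore (CStarModule.normedSpaceCore A)

noncomputable instance : NormedSpace ℂ (StandardModule A J) :=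
  NormedSpace.ofCore (CStarModule.normedSpaceCore A)

theorem inner_def (f g : StandardModule A J) : inner A f g = ∑' j, star (f j) * g j := rfl

theorem norm_sq_eq_tsum (f : StandardModule A J) : ‖f‖ ^ 2 = ‖∑' j, star (f j) * f j‖ :=
  CStarModule.norm_sq_eq A

theorem norm_sum_le (f : StandardModule A J) (s : Finset J) :
    ‖∑ j ∈ s, star (f j) * f j‖ ≤ ‖f‖ ^ 2 := by
  rw [norm_sq_eq_tsum]
  exact CStarAlgebra.norm_le_norm_of_nonneg_of_le
    (Finset.sum_nonneg fun j _ => star_mul_self_nonneg _)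
    ((summable_inner f f).sum_le_tsum s fun j _ => star_mul_self_nonneg _)

theorem norm_apply_le (f : StandardModule A J) (j : J) : ‖f j‖ ≤ ‖f‖ := by
  have h := norm_sum_le f {j}
  rw [Finset.sum_singleton, CStarRing.norm_star_mul_self, ← sq] at h
  exact le_of_sq_le_sq h (norm_nonneg _)

instance : CompleteSpace (StandardModule A J) := by
  refine Metric.complete_of_cauchySeq_tendsto fun u hu => ?_
  have hc (j : J) : CauchySeq fun n => u n j := by
    rw [Metric.cauchySeq_iff] at hu ⊢
    intro ε hε
    obtain ⟨N, hN⟩ := hu ε hε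
    refine ⟨N, fun m hm n hn => lt_of_le_of_lt ?_ (hN m hm n hn)⟩
    rw [dist_eq_norm, dist_eq_norm]
    exact norm_apply_le (u m - u n) j
  choose g hg using fun j => cauchySeq_tendsto_of_complete (hc j)
  have key : ∀ ε > 0, ∃ N, ∀ n ≥ N, ∀ s : Finset J,
      ‖∑ j ∈ s, star (u n j - g j) * (u n j - g j)‖ ≤ ε := by
    intro ε hε
    obtain ⟨N, hN⟩ := Metric.cauchySeq_iff.1 hu (√ε) (Real.sqrt_pos.2 hε)
    refine ⟨N, fun n hn s => ?_⟩
    have ht : Filter.Tendsto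
        (fun m => ‖∑ j ∈ s, star (u n j - u m j) * (u n j - u m j)‖) Filter.atTop
        (nhds ‖∑ j ∈ s, star (u n j - g j) * (u n j - g j)‖) := by
      refine (tendsto_finsetSum s fun j _ => ?_).norm
      exact ((tendsto_const_nhds.sub (hg j)).star).mul (tendsto_const_nhds.sub (hg j))
    refine le_of_tendsto ht (Filter.eventually_atTop.2 ⟨N, fun m hm => ?_⟩)
    refine (norm_sum_le (u n - u m) s).trans ?_
    have h := hN n hn m hm
    rw [dist_eq_norm] at h
    exact (pow_le_pow_left₀ (norm_nonneg _) h.le 2).trans_eq (Real.sq_sqrt hε.le)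
  have hsum : Summable fun j => star (g j) * g j := by
    rw [summable_iff_vanishing_norm]
    intro ε hε
    obtain ⟨N, hN⟩ := key (ε / 8) (by positivity)
    obtain ⟨s, hs⟩ := summable_iff_vanishing_norm.1 (u N).2 (ε / 8) (by positivity)
    refine ⟨s, fun t ht => ?_⟩
    have h1 := hN N le_rfl t
    have h2 := hs t ht
    have h3 : ∑ j ∈ t, star (g j) * g j ≤
        2 • ∑ j ∈ t, star (u N j - g j) * (u N j - g j) + 2 • ∑ j ∈ t, star (u N j) * u N j := by
      rw [← sub_nonneg, Finset.smul_sum, Finset.smul_sum, ← Finset.sum_add_distrib,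
        ← Finset.sum_sub_distrib]
      refine Finset.sum_nonneg fun j _ => ?_
      have h := star_mul_self_nonneg (u N j + (u N j - g j))
      convert h using 1
      simp only [star_add, star_sub]
      ring
    have h4 := CStarAlgebra.norm_le_norm_of_nonneg_of_le
      (Finset.sum_nonneg fun j _ => star_mul_self_nonneg (g j)) h3
    have h5 := h4.trans (norm_add_le _ _)
    rw [two_nsmul, two_nsmul] at h5
    have h6 := norm_add_le (∑ j ∈ t, star (u N j - g j) * (u N j - g j))
      (∑ j ∈ t, star (u N j - g j) * (u N j - g j))
    have h7 := norm_add_le (∑ j ∈ t, star (u N j) * u N j) (∑ j ∈ t, star (u N j) * u N j)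
    linarith
  obtain ⟨v, hv⟩ : ∃ v : StandardModule A J, ∀ j, v j = g j := ⟨⟨g, hsum⟩, fun _ => rfl⟩
  simp only [← hv] at key
  refine ⟨v, Metric.tendsto_atTop.2 fun ε hε => ?_⟩
  obtain ⟨N, hN⟩ := key ((ε / 2) ^ 2) (by positivity)
  refine ⟨N, fun n hn => ?_⟩
  rw [dist_eq_norm]
  refine lt_of_le_of_lt (le_of_sq_le_sq ?_ (by positivity)) (half_lt_self hε)
  rw [norm_sq_eq_tsum]
  exact le_of_tendsto (summable_inner (u n - v) (u n - v)).hasSum.norm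
    (Filter.Eventually.of_forall fun s => hN n hn s)

end StandardModule

end StandardModule

/-!
## The universal enveloping von Neumann algebra
-/

section Ultraweak

variable (H : Type*) [NormedAddCommGroup H] [InnerProductSpace ℂ H]

/-- The ultraweak operator topology on `B(H)`: the coarsest topology for which the functionals
`T ↦ ∑ₙ ⟪ξₙ, T ηₙ⟫`, with `∑ₙ ‖ξₙ‖² < ∞` and `∑ₙ ‖ηₙ‖² < ∞`, are continuous. -/
@[reducible] noncomputable def ultraweakTopology : TopologicalSpace (H →L[ℂ] H) :=
  ⨅ p : lp (fun _ : ℕ => H) 2 × lp (fun _ : ℕ => H) 2,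
    TopologicalSpace.induced (fun T : H →L[ℂ] H => ∑' n, ⟪p.1 n, T (p.2 n)⟫_ℂ) inferInstance

end Ultraweak

section DirectSum

variable {ι : Type*} {G : ι → Type*} [∀ i, NormedAddCommGroup (G i)]
  [∀ i, InnerProductSpace ℂ (G i)]

/-- The direct sum of a bounded family of operators, acting on the Hilbert space direct sum. -/
noncomputable def lpDiagonal (T : ∀ i, G i →L[ℂ] G i) (C : ℝ) (hT : ∀ i, ‖T i‖ ≤ C) :
    lp G 2 →L[ℂ] lp G 2 :=
  LinearMap.mkContinuous
    { toFun := fun x => ⟨fun i => T i (x i), ((lp.memℓp x).norm.const_mul C).mono fun i =>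
        ((T i).le_opNorm (x i)).trans (mul_le_mul_of_nonneg_right (hT i) (norm_nonneg _))⟩
      map_add' := fun x y => by ext i; exact map_add (T i) (x i) (y i)
      map_smul' := fun c x => by ext i; exact map_smul (T i) c (x i) }
    C (fun x => by
      by_cases hι : Nonempty ι
      · have hC : 0 ≤ C := (norm_nonneg _).trans (hT hι.some)
        refine lp.norm_le_of_forall_sum_le (by simp) (by positivity) fun s => ?_
        simp only [ENNReal.toReal_ofNat, Real.rpow_two, mul_pow]
        refine le_trans ?_ (mul_le_mul_of_nonneg_left
          (by simpa using lp.sum_rpow_le_norm_rpow (p := 2) (by simp) x s) (sq_nonneg C))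
        rw [Finset.mul_sum]
        refine Finset.sum_le_sum fun i _ => ?_
        rw [← mul_pow]
        exact pow_le_pow_left₀ (norm_nonneg _) (((T i).le_opNorm (x i)).trans
          (mul_le_mul_of_nonneg_right (hT i) (norm_nonneg _))) 2
      · have : IsEmpty ι := not_nonempty_iff.1 hι
        have h (y : lp G 2) : y = 0 := by ext i; exact isEmptyElim i
        refine le_of_eq ((congrArg norm (h _)).trans ?_)
        rw [h x]
        simp)

@[simp] theorem lpDiagonal_apply (T : ∀ i, G i →L[ℂ] G i) (C : ℝ) (hT : ∀ i, ‖T i‖ ≤ C)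
    (x : lp G 2) (i : ι) : lpDiagonal T C hT x i = T i (x i) := rfl

end DirectSum

section UniversalRepresentation

variable (A : Type*) [CStarAlgebra A] [PartialOrder A]

/-- The states of `A`. -/
def CStarState : Type _ := {φ : A →ₚ[ℂ] ℂ // φ 1 = 1}

variable [StarOrderedRing A]

/-- The Hilbert space of the universal representation: the direct sum of the GNS spaces of all
states. -/
abbrev UniversalSpace : Type _ := lp (fun φ : CStarState A => φ.1.GNS) 2

/-- The universal representation: the direct sum of the GNS representations of all states. -/
noncomputable def universalRep : A →⋆ₐ[ℂ] (UniversalSpace A →L[ℂ] UniversalSpace A) where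
  toFun a := lpDiagonal (fun φ : CStarState A => φ.1.gnsStarAlgHom a) ‖a‖ fun φ =>
    NonUnitalStarAlgHom.norm_apply_le φ.1.gnsStarAlgHom a
  map_one' := by ext x φ; simp
  map_mul' a b := by ext x φ; simp
  map_zero' := by ext x φ; simp
  map_add' a b := by ext x φ; simp
  commutes' c := by ext x φ; simp [Algebra.algebraMap_eq_smul_one]
  map_star' a := by
    rw [ContinuousLinearMap.star_eq_adjoint, ContinuousLinearMap.eq_adjoint_iff]
    intro x y
    rw [lp.inner_eq_tsum, lp.inner_eq_tsum]
    refine tsum_congr fun φ => ?_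
    rw [lpDiagonal_apply, lpDiagonal_apply, map_star, ContinuousLinearMap.star_eq_adjoint,
      ContinuousLinearMap.adjoint_inner_left]

/-- The universal enveloping von Neumann algebra `A**` of `A`: the bicommutant of the image of the
universal representation. -/
noncomputable def envelopingVonNeumannAlgebra : VonNeumannAlgebra (UniversalSpace A) where
  toStarSubalgebra := StarSubalgebra.centralizer ℂ
    (Set.centralizer (Set.range (universalRep A)))
  centralizer_centralizer' := by
    change Set.centralizer (Set.centralizer (Set.centralizer _)) = Set.centralizer _
    rw [Set.centralizer_centralizer_centralizer]

theorem mem_envelopingVonNeumannAlgebra {T : UniversalSpace A →L[ℂ] UniversalSpace A} :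
    T ∈ envelopingVonNeumannAlgebra A ↔
      T ∈ Set.centralizer (Set.centralizer (Set.range (universalRep A))) := by
  change T ∈ Set.centralizer (_ ∪ star _) ↔ _
  rw [Set.union_eq_left.2]
  intro S hS R hR
  obtain ⟨a, rfl⟩ := hR
  have h := hS (universalRep A (star a)) ⟨star a, rfl⟩
  rw [map_star] at h
  have h' := congrArg star h
  simp only [star_mul, star_star] at h'
  exact h'.symm

end UniversalRepresentation

/-!
## Frames
-/

section Frame

variable (A : Type u) [CommCStarAlgebra A] [PartialOrder A] [StarOrderedRing A]
  {X : Type*} [NormedAddCommGroup X] [NormedSpace ℂ X] [Module A X] [CStarModule A X]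

/-- The family `(x j)` is a frame of the Hilbert `A`-module `X`: for some real `C > 0` and every
`y` in `X`, the sum `∑ ⟨y, x j⟩⟨x j, y⟩` converges ultraweakly to an element `S` of the universal
enveloping von Neumann algebra of `A`, and `C ⟨y, y⟩ ≤ S ≤ C⁻¹ ⟨y, y⟩` there. -/
def IsFrame {J : Type*} (x : J → X) : Prop :=
  ∃ C : ℝ, 0 < C ∧ ∀ y : X, ∃ S ∈ envelopingVonNeumannAlgebra A,
    Filter.Tendsto
      (fun F : Finset J => ∑ j ∈ F, universalRep A (inner A y (x j) * inner A (x j) y))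
      Filter.atTop (@nhds _ (ultraweakTopology (UniversalSpace A)) S) ∧
    universalRep A (C • inner A y y) ≤ S ∧ S ≤ universalRep A (C⁻¹ • inner A y y)

/-- A standard frame: a frame such that the sums `∑ ⟨y, x j⟩⟨x j, y⟩` converge in norm. -/
def IsStandardFrame {J : Type*} (x : J → X) : Prop :=
  IsFrame A x ∧ ∀ y : X, Summable fun j => (inner A y (x j) * inner A (x j) y : A)

end Frame

/-!
If `A` is finite-dimensional, then it has finitely many characters, each with a minimal projection
in `A`, so a Hilbert `A`-module is the orthogonal sum of the Hilbert spaces it has as fibers over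
the characters. A standard module with enough summands therefore absorbs `X`: in each fiber the
Hilbert dimension of `X` is absorbed by an infinite cardinal. A summand of a standard module has a
standard frame, since projecting the standard basis preserves the reconstruction formula.

If `A` is infinite-dimensional, there are a continuous real function `f` on its character space and
a zero `z` of `f` that is a limit of countably many points where `f > 0`. The sections
`w ↦ t ^ (-1/2) • 1_[s, s + t]`, where `t = f w` and `s` runs over `ℝ`, have inner products that
depend continuously on `w`; declaring them orthonormal where `f` vanishes, they generate a
continuous field of Hilbert spaces whose fibers are separable where `f > 0` and which contains an
uncountable orthonormal family at `z`. Evaluating the frame inequalities at characters, a frame has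
only countably many elements that do not vanish at a given point with separable fiber, hence only
countably many that do not vanish at `z`, and these cannot detect all vectors of the family.
-/

open Filter Topology WeakDual

section Ultraweak

variable {H : Type*} [NormedAddCommGroup H] [InnerProductSpace ℂ H]

theorem continuous_ultraweakTopology_tsum_inner (ξ η : lp (fun _ : ℕ => H) 2) :
    Continuous[ultraweakTopology H, inferInstance]
      fun T : H →L[ℂ] H => ∑' n, ⟪ξ n, T (η n)⟫_ℂ :=
  continuous_iff_le_induced.2 (iInf_le _ (ξ, η))

theorem continuous_ultraweakTopology_inner (ξ η : H) :
    Continuous[ultraweakTopology H, inferInstance] fun T : H →L[ℂ] H => ⟪ξ, T η⟫_ℂ := by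
  let ι (ζ : H) : lp (fun _ : ℕ => H) 2 := lp.single 2 0 ζ
  have key (T : H →L[ℂ] H) : ∑' n, ⟪ι ξ n, T (ι η n)⟫_ℂ = ⟪ξ, T η⟫_ℂ := by
    rw [tsum_eq_single 0 fun n hn => by simp [ι, Pi.single_eq_of_ne hn]]
    simp [ι]
  simpa only [key] using continuous_ultraweakTopology_tsum_inner (ι ξ) (ι η)

theorem le_ultraweakTopology : (inferInstance : TopologicalSpace (H →L[ℂ] H)) ≤
    ultraweakTopology H := by
  refine le_iInf fun p => continuous_iff_le_induced.1 ?_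
  let D : (H →L[ℂ] H) →ₗ[ℂ] lp (fun _ : ℕ => H) 2 :=
    { toFun := fun T => lpDiagonal (fun _ => T) ‖T‖ (fun _ => le_rfl) p.2
      map_add' := fun _ _ => rfl
      map_smul' := fun _ _ => rfl }
  have hD : Continuous D := AddMonoidHomClass.continuous_of_bound D ‖p.2‖ fun T => by
    rw [mul_comm]
    let T' := lpDiagonal (fun _ : ℕ => T) ‖T‖ fun _ => le_rfl
    exact T'.le_of_opNorm_le (LinearMap.mkContinuous_norm_le _ (norm_nonneg T) _) p.2
  have h (T : H →L[ℂ] H) : ∑' n, ⟪p.1 n, T (p.2 n)⟫_ℂ = ⟪p.1, D T⟫_ℂ :=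
    (lp.inner_eq_tsum (𝕜 := ℂ) p.1 (D T)).symm
  simp only [h]
  exact continuous_const.inner hD

end Ultraweak

section Characters

variable {A : Type u} [CommCStarAlgebra A]

theorem character_ext {a b : A} (h : ∀ z : characterSpace ℂ A, z a = z b) : a = b :=
  (gelfandStarTransform A).injective (ContinuousMap.ext h)

theorem character_gelfandStarTransform_symm (g : C(characterSpace ℂ A, ℂ))
    (z : characterSpace ℂ A) : z ((gelfandStarTransform A).symm g) = g z :=
  DFunLike.congr_fun ((gelfandStarTransform A).apply_symm_apply g) z

theorem norm_eq_norm_gelfandStarTransform (a : A) : ‖a‖ = ‖gelfandStarTransform A a‖ :=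
  ((gelfandTransform_isometry A).norm_map_of_map_zero (map_zero _) a).symm

theorem norm_character_le (z : characterSpace ℂ A) (a : A) : ‖z a‖ ≤ ‖a‖ :=
  norm_eq_norm_gelfandStarTransform a ▸ (gelfandStarTransform A a).norm_coe_le_norm z

variable [PartialOrder A] [StarOrderedRing A]

theorem nonneg_of_character_nonneg {a : A} (h : ∀ z : characterSpace ℂ A, 0 ≤ z a) : 0 ≤ a := by
  have hg : 0 ≤ gelfandStarTransform A a := h
  simpa using map_nonneg (gelfandStarTransform A).symm hg

/-- A character of `A`, as a state. -/
noncomputable def characterState (z : characterSpace ℂ A) : CStarState A :=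
  ⟨.mk₀ (CharacterSpace.toAlgHom z).toLinearMap fun _ ha => map_nonneg z ha, map_one z⟩

end Characters

section CyclicVector

variable {A : Type u} [CStarAlgebra A] [PartialOrder A] [StarOrderedRing A]

/-- The GNS cyclic vector of a state, in the universal representation, where it makes the state a
vector state and hence ultraweakly continuous. -/
noncomputable def cyclicVector (φ : CStarState A) : UniversalSpace A := by
  classical
  exact lp.single 2 φ ((φ.1.toPreGNS 1 : φ.1.PreGNS) : φ.1.GNS)

theorem inner_cyclicVector_universalRep (φ : CStarState A) (a : A) :
    ⟪cyclicVector φ, universalRep A a (cyclicVector φ)⟫_ℂ = φ.1 a := by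
  classical
  rw [cyclicVector, lp.inner_single_left]
  simp [universalRep, PositiveLinearMap.preGNS_inner_def]

theorem universalRep_mem_envelopingVonNeumannAlgebra (a : A) :
    universalRep A a ∈ envelopingVonNeumannAlgebra A :=
  (mem_envelopingVonNeumannAlgebra A).2 (Set.subset_centralizer_centralizer ⟨a, rfl⟩)

theorem continuous_universalRep : Continuous (universalRep A) :=
  AddMonoidHomClass.continuous_of_bound (universalRep A) 1 fun a => by
    rw [one_mul]
    exact NonUnitalStarAlgHom.norm_apply_le (universalRep A).toNonUnitalStarAlgHom a

end CyclicVector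

section Frames

variable {A : Type u} [CommCStarAlgebra A] [PartialOrder A]
  {X : Type*} [NormedAddCommGroup X] [NormedSpace ℂ X] [Module A X] [CStarModule A X]

theorem character_inner_mul_inner (z : characterSpace ℂ A) (x y : X) :
    z (inner A y x * inner A x y) = (‖z (inner A x y)‖ ^ 2 : ℝ) := by
  rw [map_mul, ← CStarModule.star_inner x y, map_star, RCLike.star_def, Complex.conj_mul',
    Complex.ofReal_pow]

variable [StarOrderedRing A] {J : Type*} {x : J → X}

theorem isStandardFrame_of_hasSum
    (h : ∀ y : X, HasSum (fun j => (inner A y (x j) * inner A (x j) y : A)) (inner A y y)) :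
    IsStandardFrame A x := by
  refine ⟨⟨1, one_pos, fun y => ⟨universalRep A (inner A y y),
    universalRep_mem_envelopingVonNeumannAlgebra _, ?_, ?_, ?_⟩⟩, fun y => (h y).summable⟩
  · have hnorm := (continuous_universalRep.tendsto _).comp (h y)
    simp only [Function.comp_def, map_sum] at hnorm
    exact hnorm.mono_right (nhds_mono le_ultraweakTopology)
  · rw [one_smul]
  · rw [inv_one, one_smul]

theorem IsFrame.exists_character_lower_bound (hx : IsFrame A x) :
    ∃ C : ℝ, 0 < C ∧ ∀ (z : characterSpace ℂ A) (y : X),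
      Summable (fun j => ‖z (inner A (x j) y)‖ ^ 2) ∧
        C * (z (inner A y y)).re ≤ ∑' j, ‖z (inner A (x j) y)‖ ^ 2 := by
  obtain ⟨C, hC, hx⟩ := hx
  refine ⟨C, hC, fun z y => ?_⟩
  obtain ⟨S, -, hS, hCS, -⟩ := hx y
  let ξ := cyclicVector (characterState z)
  have hξ (a : A) : ⟪ξ, universalRep A a ξ⟫_ℂ = z a := inner_cyclicVector_universalRep _ a
  have hsum : HasSum (fun j => ‖z (inner A (x j) y)‖ ^ 2) (⟪ξ, S ξ⟫_ℂ).re := by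
    have hlim := (@Continuous.tendsto _ _ (ultraweakTopology _) _ _
      (continuous_ultraweakTopology_inner ξ ξ) S).comp hS
    refine ((Complex.continuous_re.tendsto _).comp hlim).congr fun F => ?_
    simp only [Function.comp_apply]
    rw [← map_sum, hξ, map_sum, Complex.re_sum]
    simp only [character_inner_mul_inner, Complex.ofReal_re]
  refine ⟨hsum.summable, hsum.tsum_eq ▸ ?_⟩
  have hle := ((ContinuousLinearMap.le_def _ _).1 hCS).inner_nonneg_right ξ
  rw [sub_apply, inner_sub_right, sub_nonneg, hξ, ← Complex.coe_smul, map_smul] at hle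
  simpa using (Complex.le_def.1 hle).1

end Frames

namespace StandardModule

variable {A : Type*} [CommCStarAlgebra A] [PartialOrder A] [StarOrderedRing A] {J : Type*}

theorem ext {f g : StandardModule A J} (h : ∀ j, f j = g j) : f = g := Subtype.ext (funext h)

variable [DecidableEq J]

/-- The family in `⊕_{j ∈ J} A` whose only possibly nonzero entry is `a`, at `j`. -/
def single (j : J) (a : A) : StandardModule A J :=
  ⟨Pi.single j a, summable_of_ne_finset_zero (s := {j}) fun i hi => by
    simp [Pi.single_eq_of_ne (Finset.notMem_singleton.1 hi)]⟩

theorem single_apply (j : J) (a : A) (i : J) :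
    single j a i = (Pi.single j a : J → A) i := rfl

theorem inner_single_left (j : J) (a : A) (f : StandardModule A J) :
    inner A (single j a) f = star a * f j := by
  rw [inner_def, tsum_eq_single j fun i hi => by simp [single_apply, Pi.single_eq_of_ne hi],
    single_apply, Pi.single_eq_same]

theorem hasSum_inner_single_mul (f : StandardModule A J) :
    HasSum (fun j => (inner A f (single j (1 : A)) * inner A (single j (1 : A)) f : A))
      (inner A f f) := by
  refine (summable_inner f f).hasSum.congr_fun fun j => ?_
  rw [← CStarModule.star_inner (single j 1) f, inner_single_left, star_one, one_mul]

end StandardModule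

theorem HilbertModuleIso.exists_isStandardFrame
    {A : Type u} [CommCStarAlgebra A] [PartialOrder A] [StarOrderedRing A]
    {X : Type*} [NormedAddCommGroup X] [NormedSpace ℂ X] [Module A X] [CStarModule A X]
    {Y : Type*} [NormedAddCommGroup Y] [NormedSpace ℂ Y] [Module A Y] [CStarModule A Y]
    {J : Type*} (h : HilbertModuleIso A C⋆ᵐᵒᵈ(A, X × Y) (StandardModule A J)) :
    ∃ x : J → X, IsStandardFrame A x := by
  classical
  obtain ⟨e, he⟩ := h
  let δ (j : J) : StandardModule A J := StandardModule.single j 1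
  refine ⟨fun j => (e.symm (δ j)).1, isStandardFrame_of_hasSum fun y => ?_⟩
  let v : C⋆ᵐᵒᵈ(A, X × Y) := (WithCStarModule.equiv A (X × Y)).symm (y, 0)
  have inner_v (w : C⋆ᵐᵒᵈ(A, X × Y)) : inner A w.1 y = inner A (e w) (e v) := by
    simp [he, WithCStarModule.prod_inner, v]
  have inner_δ (j : J) : inner A (e.symm (δ j)).1 y = inner A (δ j) (e v) := by
    rw [inner_v, e.apply_symm_apply]
  have inner_y : inner A y y = inner A (e v) (e v) := inner_v v
  rw [inner_y]
  refine (StandardModule.hasSum_inner_single_mul (e v)).congr_fun fun j => ?_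
  rw [← CStarModule.star_inner _ y, inner_δ, CStarModule.star_inner]

section HilbertBases

variable {ι κ E F : Type*} [NormedAddCommGroup E] [InnerProductSpace ℂ E]
  [NormedAddCommGroup F] [InnerProductSpace ℂ F]

theorem exists_hilbertBasis_coe_eq [CompleteSpace E] {v : ι → E} (hv : Orthonormal ℂ v)
    (h : ∀ x, (∀ i, ⟪v i, x⟫_ℂ = 0) → x = 0) : ∃ b : HilbertBasis ι ℂ E, ⇑b = v := by
  refine ⟨.mkOfOrthogonalEqBot hv ((Submodule.eq_bot_iff _).2 fun x hx => h x fun i => ?_),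
    HilbertBasis.coe_mkOfOrthogonalEqBot ..⟩
  exact hx _ (Submodule.subset_span ⟨i, rfl⟩)

theorem eq_zero_of_inner_hilbertBasis_eq_zero (b : HilbertBasis ι ℂ E) {x : E}
    (h : ∀ i, ⟪b i, x⟫_ℂ = 0) : x = 0 :=
  b.repr.map_eq_zero_iff.1 <| lp.ext <| funext fun i => (b.repr_apply_apply x i).trans (h i)

theorem nonempty_linearIsometryEquiv_of_hilbertBasis [CompleteSpace E]
    (b : HilbertBasis ι ℂ E) (b' : HilbertBasis κ ℂ F) (σ : ι ≃ κ) : Nonempty (E ≃ₗᵢ[ℂ] F) := by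
  obtain ⟨c, -⟩ := exists_hilbertBasis_coe_eq (b.orthonormal.comp σ.symm σ.symm.injective)
    fun x hx => eq_zero_of_inner_hilbertBasis_eq_zero b fun i => by simpa using hx (σ i)
  exact ⟨c.repr.trans b'.repr.symm⟩

end HilbertBases

section ScalarTower

variable {A : Type*} [CStarAlgebra A] [PartialOrder A]
  {X : Type*} [NormedAddCommGroup X] [NormedSpace ℂ X] [Module A X] [CStarModule A X]

variable (A) in
theorem eq_of_forall_inner_right_eq {x y : X} (h : ∀ w : X, inner A w x = inner A w y) : x = y := by
  rw [← sub_eq_zero, ← CStarModule.inner_self (A := A), CStarModule.inner_sub_right, h, sub_self]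

instance isScalarTower_of_cstarModule : IsScalarTower ℂ A X where
  smul_assoc c a x := eq_of_forall_inner_right_eq A fun w => by
    rw [CStarModule.inner_op_smul_right, CStarModule.inner_smul_right_complex,
      CStarModule.inner_op_smul_right, smul_mul_assoc]

end ScalarTower

section CharacterFiber

variable {A : Type*} [CommCStarAlgebra A] [PartialOrder A]
  {X : Type*} [NormedAddCommGroup X] [NormedSpace ℂ X] [Module A X] [CStarModule A X]

variable (X) in
/-- The fiber of a Hilbert module `X` at a character `z`, realized inside `X` as the subspace on
which every `a` acts as the scalar `z a`. Such a subspace sees all of the fiber only when `z` is an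
isolated point of the spectrum, as it is when the algebra is finite-dimensional. -/
def characterFiber (z : characterSpace ℂ A) : Submodule ℂ X where
  carrier := {x | ∀ a : A, a • x = z a • x}
  zero_mem' a := by rw [smul_zero, smul_zero]
  add_mem' hx hy a := by rw [smul_add, smul_add, hx a, hy a]
  smul_mem' c x hx a := by rw [smul_comm, hx a, smul_comm]

variable {z : characterSpace ℂ A}

namespace characterFiber

theorem smul_coe (a : A) (x : characterFiber X z) : a • (x : X) = z a • (x : X) := x.2 a

theorem norm_sq_eq (x : characterFiber X z) : ‖x‖ ^ 2 = ‖z (inner A (x : X) (x : X))‖ := by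
  set b : A := inner A (x : X) (x : X) with hb
  have hbb : star b * b = z b • b := by
    rw [hb, CStarModule.star_inner, ← CStarModule.inner_op_smul_right, smul_coe,
      CStarModule.inner_smul_right_complex]
  have hnorm : ‖b‖ * ‖b‖ = ‖z b‖ * ‖b‖ := by
    rw [← CStarRing.norm_star_mul_self, hbb, norm_smul]
  rw [Submodule.coe_norm, CStarModule.norm_sq_eq A, ← hb]
  rcases eq_or_ne b 0 with h0 | h0
  · rw [h0, map_zero, norm_zero, norm_zero]
  · exact mul_right_cancel₀ (norm_ne_zero_iff.2 h0) hnorm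

variable [StarOrderedRing A]

instance [CompleteSpace X] : CompleteSpace (characterFiber X z) := by
  suffices IsClosed (characterFiber X z : Set X) from this.completeSpace_coe
  have h : (characterFiber X z : Set X) =
      ⋂ (a : A) (w : X), {x | a * inner A w x = z a • inner A w x} := by
    ext x
    simp only [Set.mem_iInter, Set.mem_ofPred_eq, ← CStarModule.inner_op_smul_right,
      ← CStarModule.inner_smul_right_complex]
    exact ⟨fun hx a w => by rw [hx a], fun hx a => eq_of_forall_inner_right_eq A (hx a)⟩
  rw [h]
  have hc (w : X) : Continuous fun x : X => inner A w x :=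
    (CStarModule.innerSL (A := A) w).continuous
  exact isClosed_iInter fun a => isClosed_iInter fun w =>
    isClosed_eq ((hc w).const_mul a) ((hc w).const_smul (z a))

noncomputable instance : InnerProductSpace ℂ (characterFiber X z) where
  inner x y := z (inner A (x : X) (y : X))
  norm_sq_eq_re_inner x := by
    have h0 : 0 ≤ z (inner A (x : X) (x : X)) := map_nonneg z CStarModule.inner_self_nonneg
    rw [norm_sq_eq, ← Complex.ofReal_re ‖_‖, Complex.norm_of_nonneg' h0, RCLike.re_to_complex]
  conj_inner_symm x y := by
    rw [← RCLike.star_def, ← map_star, CStarModule.star_inner]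
  add_left x y w := by rw [Submodule.coe_add, CStarModule.inner_add_left, map_add]
  smul_left x y c := by
    rw [Submodule.coe_smul, CStarModule.inner_smul_left_complex, map_smul]; rfl

theorem inner_def (x y : characterFiber X z) :
    ⟪x, y⟫_ℂ = z (inner A (x : X) (y : X)) := rfl

end characterFiber

end CharacterFiber

section FiniteSpectrum

variable {A : Type*} [CommCStarAlgebra A]

instance finite_characterSpace [FiniteDimensional ℂ A] : Finite (characterSpace ℂ A) :=
  .of_injective (fun z : characterSpace ℂ A => CharacterSpace.toAlgHom z) fun _ _ h =>
    CharacterSpace.ext fun a => DFunLike.congr_fun h a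

variable (A) in
theorem finiteDimensional_of_finite_characterSpace [Finite (characterSpace ℂ A)] :
    FiniteDimensional ℂ A :=
  .of_injective (LinearMap.pi fun z => (CharacterSpace.toAlgHom z).toLinearMap :
    A →ₗ[ℂ] characterSpace ℂ A → ℂ) fun _ _ h => character_ext fun z => congrFun h z

variable [Finite (characterSpace ℂ A)] [DecidableEq (characterSpace ℂ A)]

/-- The minimal projection of a finite-dimensional algebra that belongs to the character `z`. -/
noncomputable def minimalProjection (z : characterSpace ℂ A) : A :=
  (gelfandStarTransform A).symm ⟨Pi.single z 1, continuous_of_discreteTopology⟩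

theorem character_minimalProjection (w z : characterSpace ℂ A) :
    w (minimalProjection z) = if w = z then 1 else 0 :=
  (character_gelfandStarTransform_symm _ w).trans (Pi.single_apply z 1 w)

theorem character_minimalProjection_self (z : characterSpace ℂ A) :
    z (minimalProjection z) = 1 := by
  rw [character_minimalProjection, if_pos rfl]

theorem mul_minimalProjection (a : A) (z : characterSpace ℂ A) :
    a * minimalProjection z = z a • minimalProjection z :=
  character_ext fun w => by
    rw [map_mul, map_smul, character_minimalProjection, smul_eq_mul]
    split_ifs with h
    · rw [h]
    · rw [mul_zero, mul_zero]

theorem star_minimalProjection (z : characterSpace ℂ A) :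
    star (minimalProjection z) = minimalProjection z :=
  character_ext fun w => by
    rw [map_star, character_minimalProjection]
    split_ifs <;> simp

theorem sum_minimalProjection [Fintype (characterSpace ℂ A)] :
    ∑ z : characterSpace ℂ A, minimalProjection z = 1 :=
  character_ext fun w => by simp [map_sum, character_minimalProjection]

end FiniteSpectrum

section CharacterDecomposition

variable {A : Type*} [CommCStarAlgebra A] [PartialOrder A]
  [DecidableEq (characterSpace ℂ A)]
  {X : Type*} [NormedAddCommGroup X] [NormedSpace ℂ X] [Module A X] [CStarModule A X]

theorem minimalProjection_smul_characterFiber [Finite (characterSpace ℂ A)]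
    {w z : characterSpace ℂ A} (x : characterFiber X z) :
    minimalProjection w • (x : X) = if z = w then (x : X) else 0 := by
  rw [characterFiber.smul_coe, character_minimalProjection, ite_smul, one_smul, zero_smul]

variable [Fintype (characterSpace ℂ A)]

variable (X) in
/-- Over a finite-dimensional algebra, a Hilbert module is the direct sum of its fibers. -/
noncomputable def characterDecomposition :
    X ≃ₗ[ℂ] ∀ z : characterSpace ℂ A, characterFiber X z where
  toFun x z := ⟨minimalProjection z • x, fun a => by
    rw [smul_smul, mul_minimalProjection, smul_assoc]⟩
  map_add' x y := funext fun z => Subtype.ext (smul_add _ x y)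
  map_smul' c x := funext fun z => Subtype.ext (smul_comm _ c x)
  invFun u := ∑ z, (u z : X)
  left_inv x := by
    change ∑ z : characterSpace ℂ A, minimalProjection z • x = x
    rw [← Finset.sum_smul, sum_minimalProjection, one_smul]
  right_inv u := funext fun z => Subtype.ext <| by
    simp [Finset.smul_sum, minimalProjection_smul_characterFiber]

theorem coe_characterDecomposition (x : X) (z : characterSpace ℂ A) :
    (characterDecomposition X x z : X) = minimalProjection z • x := rfl

theorem characterDecomposition_smul (a : A) (x : X) (z : characterSpace ℂ A) :
    characterDecomposition X (a • x) z = z a • characterDecomposition X x z :=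
  Subtype.ext <| by
    rw [Submodule.coe_smul, coe_characterDecomposition, coe_characterDecomposition, smul_smul,
      mul_comm, mul_minimalProjection, smul_assoc]

variable [StarOrderedRing A]

theorem inner_characterDecomposition (x y : X) (z : characterSpace ℂ A) :
    ⟪characterDecomposition X x z, characterDecomposition X y z⟫_ℂ = z (inner A x y) := by
  rw [characterFiber.inner_def, coe_characterDecomposition, coe_characterDecomposition,
    CStarModule.inner_op_smul_left, CStarModule.inner_op_smul_right, star_minimalProjection,
    map_mul, map_mul, character_minimalProjection_self, one_mul, mul_one]

end CharacterDecomposition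

theorem hilbertModuleIso_of_characterFiber
    {A : Type*} [CommCStarAlgebra A] [PartialOrder A] [StarOrderedRing A]
    [Finite (characterSpace ℂ A)]
    {X : Type*} [NormedAddCommGroup X] [NormedSpace ℂ X] [Module A X] [CStarModule A X]
    {Y : Type*} [NormedAddCommGroup Y] [NormedSpace ℂ Y] [Module A Y] [CStarModule A Y]
    (h : ∀ z : characterSpace ℂ A, Nonempty (characterFiber X z ≃ₗᵢ[ℂ] characterFiber Y z)) :
    HilbertModuleIso A X Y := by
  classical
  have := Fintype.ofFinite (characterSpace ℂ A)
  let U (z : characterSpace ℂ A) := (h z).some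
  let e : X ≃ₗ[ℂ] Y := characterDecomposition X ≪≫ₗ
    LinearEquiv.piCongrRight (fun z => (U z).toLinearEquiv) ≪≫ₗ (characterDecomposition Y).symm
  have he (x : X) (z : characterSpace ℂ A) :
      characterDecomposition Y (e x) z = U z (characterDecomposition X x z) := by
    simp [e]
  have e_smul (a : A) (x : X) : e (a • x) = a • e x :=
    (characterDecomposition Y).injective <| funext fun z => by
      rw [he, characterDecomposition_smul, characterDecomposition_smul, map_smul, he]
  refine ⟨{ e with map_smul' := e_smul }, fun x y => character_ext fun z => ?_⟩
  change z (inner A (e x) (e y)) = _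
  rw [← inner_characterDecomposition, he, he, LinearIsometryEquiv.inner_map_map,
    inner_characterDecomposition]

theorem nonempty_hilbertBasis_prod {ι κ E F : Type*}
    [NormedAddCommGroup E] [InnerProductSpace ℂ E] [CompleteSpace E]
    [NormedAddCommGroup F] [InnerProductSpace ℂ F] [CompleteSpace F]
    (b : HilbertBasis ι ℂ E) (c : HilbertBasis κ ℂ F) :
    Nonempty (HilbertBasis (ι ⊕ κ) ℂ (WithLp 2 (E × F))) := by
  classical
  let v : ι ⊕ κ → WithLp 2 (E × F) :=
    Sum.elim (fun i => WithLp.toLp 2 (b i, 0)) fun j => WithLp.toLp 2 (0, c j)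
  have hv : Orthonormal ℂ v := by
    have hb := orthonormal_iff_ite.1 b.orthonormal
    have hc := orthonormal_iff_ite.1 c.orthonormal
    rw [orthonormal_iff_ite]
    rintro (i | i) (j | j) <;> simp [v, WithLp.prod_inner_apply, hb, hc]
  have htotal (x : WithLp 2 (E × F)) (hx : ∀ i, ⟪v i, x⟫_ℂ = 0) : x = 0 := by
    have h₁ : x.fst = 0 := eq_zero_of_inner_hilbertBasis_eq_zero b fun i => by
      simpa [v, WithLp.prod_inner_apply] using hx (.inl i)
    have h₂ : x.snd = 0 := eq_zero_of_inner_hilbertBasis_eq_zero c fun j => by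
      simpa [v, WithLp.prod_inner_apply] using hx (.inr j)
    exact WithLp.ofLp_injective 2 (Prod.ext h₁ h₂)
  exact ⟨(exists_hilbertBasis_coe_eq hv htotal).choose⟩

theorem nonempty_linearIsometryEquiv_prod {κ E F : Type u} [Infinite κ]
    [NormedAddCommGroup E] [InnerProductSpace ℂ E] [CompleteSpace E]
    [NormedAddCommGroup F] [InnerProductSpace ℂ F] [CompleteSpace F] (b : HilbertBasis κ ℂ F)
    (f : E ↪ κ) : Nonempty (WithLp 2 (E × F) ≃ₗᵢ[ℂ] F) := by
  obtain ⟨w, c, -⟩ := exists_hilbertBasis ℂ E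
  obtain ⟨b'⟩ := nonempty_hilbertBasis_prod c b
  obtain ⟨σ⟩ : Nonempty (w ⊕ κ ≃ κ) := by
    rw [← Cardinal.eq, ← Cardinal.add_def]
    exact Cardinal.add_eq_right (Cardinal.infinite_iff.1 inferInstance)
      (Cardinal.mk_le_of_injective (f.injective.comp Subtype.val_injective))
  exact nonempty_linearIsometryEquiv_of_hilbertBasis b' b σ

section Pairs

variable {A : Type*} [CommCStarAlgebra A] [PartialOrder A] [StarOrderedRing A]
  (X : Type*) [NormedAddCommGroup X] [NormedSpace ℂ X] [Module A X] [CStarModule A X]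
  (Y : Type*) [NormedAddCommGroup Y] [NormedSpace ℂ Y] [Module A Y] [CStarModule A Y]

/-- The fiber of a direct sum is the Hilbert space direct sum of the fibers. -/
noncomputable def characterFiberProd (z : characterSpace ℂ A) :
    characterFiber C⋆ᵐᵒᵈ(A, X × Y) z ≃ₗᵢ[ℂ] WithLp 2 (characterFiber X z × characterFiber Y z) :=
  LinearEquiv.isometryOfInner
    { toFun := fun v => WithLp.toLp 2 (⟨v.1.1, fun a => congrArg Prod.fst (v.2 a)⟩,
        ⟨v.1.2, fun a => congrArg Prod.snd (v.2 a)⟩)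
      map_add' := fun _ _ => rfl
      map_smul' := fun _ _ => rfl
      invFun := fun w => ⟨(WithCStarModule.equiv A (X × Y)).symm (w.fst, w.snd),
        fun a => Prod.ext (w.fst.2 a) (w.snd.2 a)⟩
      left_inv := fun _ => rfl
      right_inv := fun _ => rfl } fun _ _ => (map_add z _ _).symm

end Pairs

section Absorption

variable {A : Type*} [CommCStarAlgebra A] [PartialOrder A] [StarOrderedRing A]
  [Finite (characterSpace ℂ A)] {J : Type*}

namespace StandardModule

open Classical in
/-- The standard orthonormal basis of the fiber of `⊕_{j ∈ J} A` at the character `z`. -/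
noncomputable def fiberSingle (z : characterSpace ℂ A) (j : J) :
    characterFiber (StandardModule A J) z :=
  ⟨single j (minimalProjection z), fun a => ext fun i => by
    rw [smul_apply, complex_smul_apply, single_apply]
    rcases eq_or_ne i j with rfl | h
    · rw [Pi.single_eq_same, mul_minimalProjection]
    · rw [Pi.single_eq_of_ne h, mul_zero, smul_zero]⟩

theorem inner_fiberSingle (z : characterSpace ℂ A) (j : J)
    (f : characterFiber (StandardModule A J) z) :
    ⟪fiberSingle z j, f⟫_ℂ = z ((f : StandardModule A J) j) := by
  classical
  rw [characterFiber.inner_def, fiberSingle, inner_single_left, star_minimalProjection, map_mul,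
    character_minimalProjection_self, one_mul]

theorem orthonormal_fiberSingle (z : characterSpace ℂ A) :
    Orthonormal ℂ (fiberSingle (J := J) z) := by
  classical
  rw [orthonormal_iff_ite]
  intro i j
  rw [inner_fiberSingle, fiberSingle, single_apply, Pi.single_apply]
  split_ifs
  · exact character_minimalProjection_self z
  · exact map_zero z

theorem eq_zero_of_inner_fiberSingle_eq_zero {z : characterSpace ℂ A}
    {f : characterFiber (StandardModule A J) z} (h : ∀ j, ⟪fiberSingle z j, f⟫_ℂ = 0) : f = 0 := by
  refine Subtype.ext (ext fun j => (CStarRing.star_mul_self_eq_zero_iff _).1 ?_)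
  have hj : z ((f : StandardModule A J) j) = 0 := (inner_fiberSingle z j f).symm.trans (h j)
  rw [← smul_apply, characterFiber.smul_coe, map_star, hj, star_zero, zero_smul]
  rfl

variable (J) in
theorem nonempty_hilbertBasis_characterFiber (z : characterSpace ℂ A) :
    Nonempty (HilbertBasis J ℂ (characterFiber (StandardModule A J) z)) :=
  ⟨(exists_hilbertBasis_coe_eq (orthonormal_fiberSingle z) fun _ h =>
    eq_zero_of_inner_fiberSingle_eq_zero h).choose⟩

end StandardModule

end Absorption

theorem exists_hilbertModuleIso_prod_standardModule
    {A : Type u} [CommCStarAlgebra A] [PartialOrder A] [StarOrderedRing A]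
    [Finite (characterSpace ℂ A)] (X : Type u) [NormedAddCommGroup X] [NormedSpace ℂ X]
    [Module A X] [CStarModule A X] [CompleteSpace X] :
    ∃ J : Type u, HilbertModuleIso A C⋆ᵐᵒᵈ(A, X × StandardModule A J) (StandardModule A J) := by
  refine ⟨ℕ × X, hilbertModuleIso_of_characterFiber fun z => ?_⟩
  obtain ⟨b⟩ := StandardModule.nonempty_hilbertBasis_characterFiber (ℕ × X) z
  let f : characterFiber X z ↪ ℕ × X :=
    ⟨fun x => (0, x), (Prod.mk_right_injective 0).comp Subtype.val_injective⟩
  obtain ⟨U⟩ := nonempty_linearIsometryEquiv_prod b f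
  exact ⟨(characterFiberProd X _ z).trans U⟩

theorem topologicalClosure_span_range_le {R M ι : Type*} [Semiring R] [TopologicalSpace M]
    [AddCommMonoid M] [Module R M] [ContinuousConstSMul R M] [ContinuousAdd M] {v : ι → M}
    {N : Submodule R M} (hN : IsClosed (N : Set M)) (h : ∀ i, v i ∈ N) :
    (Submodule.span R (Set.range v)).topologicalClosure ≤ N :=
  Submodule.topologicalClosure_minimal _ (Submodule.span_le.2 (Set.range_subset_iff.2 h)) hN

/-- The bounded, not necessarily continuous, maps from the spectrum of `A` to `H`, with the supremum
norm. -/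
def BoundedField (A : Type*) [CommCStarAlgebra A] (H : Type*) [NormedAddCommGroup H] : Type _ :=
  lp (fun _ : characterSpace ℂ A => H) ∞

namespace BoundedField

variable {A H : Type*} [CommCStarAlgebra A] [NormedAddCommGroup H]

noncomputable instance : NormedAddCommGroup (BoundedField A H) :=
  inferInstanceAs (NormedAddCommGroup (lp (fun _ : characterSpace ℂ A => H) ∞))

instance : CoeFun (BoundedField A H) fun _ => characterSpace ℂ A → H := ⟨Subtype.val⟩

theorem ext {ξ η : BoundedField A H} (h : ∀ z, ξ z = η z) : ξ = η := lp.ext (funext h)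

theorem add_apply (ξ η : BoundedField A H) (z : characterSpace ℂ A) : (ξ + η) z = ξ z + η z := rfl

theorem sub_apply (ξ η : BoundedField A H) (z : characterSpace ℂ A) : (ξ - η) z = ξ z - η z := rfl

theorem norm_apply_le (ξ : BoundedField A H) (z : characterSpace ℂ A) : ‖ξ z‖ ≤ ‖ξ‖ :=
  lp.norm_apply_le_norm ENNReal.top_ne_zero ξ z

theorem norm_le {ξ : BoundedField A H} {C : ℝ} (hC : 0 ≤ C) (h : ∀ z, ‖ξ z‖ ≤ C) : ‖ξ‖ ≤ C :=
  lp.norm_le_of_forall_le hC h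

instance [CompleteSpace H] : CompleteSpace (BoundedField A H) :=
  inferInstanceAs (CompleteSpace (lp (fun _ : characterSpace ℂ A => H) ∞))

theorem continuous_eval (z : characterSpace ℂ A) : Continuous fun ξ : BoundedField A H => ξ z :=
  (LipschitzWith.of_dist_le_mul (K := 1) fun ξ η => by
    rw [NNReal.coe_one, one_mul, dist_eq_norm, dist_eq_norm]
    exact norm_apply_le (ξ - η) z).continuous

variable [NormedSpace ℂ H]

noncomputable instance : NormedSpace ℂ (BoundedField A H) :=
  inferInstanceAs (NormedSpace ℂ (lp (fun _ : characterSpace ℂ A => H) ∞))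

theorem complex_smul_apply (c : ℂ) (ξ : BoundedField A H) (z : characterSpace ℂ A) :
    (c • ξ) z = c • ξ z := rfl

theorem norm_character_smul_le (a : A) (ξ : BoundedField A H) (z : characterSpace ℂ A) :
    ‖z a • ξ z‖ ≤ ‖a‖ * ‖ξ‖ := by
  rw [norm_smul]
  exact mul_le_mul (norm_character_le z a) (norm_apply_le ξ z) (norm_nonneg _) (norm_nonneg _)

noncomputable instance : Module A (BoundedField A H) where
  smul a ξ := ⟨fun z => z a • ξ z,
    memℓp_infty ⟨‖a‖ * ‖ξ‖, Set.forall_mem_range.2 (norm_character_smul_le a ξ)⟩⟩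
  one_smul ξ := ext fun z => (congrArg (· • ξ z) (map_one z)).trans (one_smul ℂ _)
  mul_smul a b ξ := ext fun z => (congrArg (· • ξ z) (map_mul z a b)).trans (mul_smul _ _ _)
  smul_zero a := ext fun z => smul_zero (z a)
  smul_add a ξ η := ext fun z => smul_add (z a) (ξ z) (η z)
  add_smul a b ξ := ext fun z => (congrArg (· • ξ z) (map_add z a b)).trans (add_smul _ _ _)
  zero_smul ξ := ext fun z => (congrArg (· • ξ z) (map_zero z)).trans (zero_smul ℂ _)

theorem smul_apply (a : A) (ξ : BoundedField A H) (z : characterSpace ℂ A) :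
    (a • ξ) z = z a • ξ z := rfl

theorem norm_smul_le (a : A) (ξ : BoundedField A H) : ‖a • ξ‖ ≤ ‖a‖ * ‖ξ‖ :=
  norm_le (by positivity) (norm_character_smul_le a ξ)

instance : ContinuousConstSMul A (BoundedField A H) where
  continuous_const_smul a := AddMonoidHomClass.continuous_of_bound
    (DistribSMul.toAddMonoidHom (BoundedField A H) a) ‖a‖ (norm_smul_le a)

instance : IsScalarTower ℂ A (BoundedField A H) where
  smul_assoc c a ξ := ext fun z => by
    rw [smul_apply, complex_smul_apply, smul_apply, map_smul, smul_assoc]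

end BoundedField

/-- A continuous field of Hilbert spaces over the spectrum of `A`, all inside a single Hilbert space
`H`: a closed module of bounded sections whose pointwise inner products are continuous. The sections
themselves need not be continuous as maps to `H`. -/
structure ContinuousField (A H : Type*) [CommCStarAlgebra A] [NormedAddCommGroup H]
    [InnerProductSpace ℂ H] extends Submodule A (BoundedField A H) where
  isClosed : IsClosed (toSubmodule : Set (BoundedField A H))
  continuous_inner : ∀ ξ ∈ toSubmodule, ∀ η ∈ toSubmodule, Continuous fun z => ⟪ξ z, η z⟫_ℂ

namespace ContinuousField

variable {A H : Type*} [CommCStarAlgebra A] [NormedAddCommGroup H] [InnerProductSpace ℂ H]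

section Sections

variable (F : ContinuousField A H)

instance [CompleteSpace H] : CompleteSpace F.toSubmodule := F.isClosed.completeSpace_coe

noncomputable instance : Inner A F.toSubmodule where
  inner ξ η := (gelfandStarTransform A).symm ⟨_, F.continuous_inner _ ξ.2 _ η.2⟩

variable {F}

theorem character_inner (ξ η : F.toSubmodule) (z : characterSpace ℂ A) :
    z (inner A ξ η) = ⟪ξ.1 z, η.1 z⟫_ℂ :=
  character_gelfandStarTransform_symm _ z

theorem apply_eq_zero_of_mem_closure (ξ : F.toSubmodule) {S : Set (characterSpace ℂ A)}
    (h : ∀ w ∈ S, ξ.1 w = 0) {z : characterSpace ℂ A} (hz : z ∈ closure S) : ξ.1 z = 0 := by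
  have hclosed : IsClosed {w | ⟪ξ.1 w, ξ.1 w⟫_ℂ = 0} :=
    isClosed_eq (F.continuous_inner _ ξ.2 _ ξ.2) continuous_const
  exact inner_self_eq_zero.1 <|
    closure_minimal (fun w hw => inner_self_eq_zero.2 (h w hw)) hclosed hz

theorem norm_inner_self (ξ : F.toSubmodule) : ‖(inner A ξ ξ : A)‖ = ‖ξ‖ ^ 2 := by
  have hz (z : characterSpace ℂ A) : ‖z (inner A ξ ξ)‖ = ‖ξ.1 z‖ ^ 2 := by
    rw [character_inner, inner_self_eq_norm_sq_to_K, norm_pow, RCLike.norm_ofReal, abs_norm]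
  refine le_antisymm ?_ ((Real.le_sqrt (norm_nonneg _) (norm_nonneg _)).1 ?_)
  · rw [norm_eq_norm_gelfandStarTransform]
    refine (ContinuousMap.norm_le _ (sq_nonneg _)).2 fun z => (hz z).trans_le ?_
    exact pow_le_pow_left₀ (norm_nonneg _) (BoundedField.norm_apply_le ξ.1 z) 2
  · refine BoundedField.norm_le (Real.sqrt_nonneg _) fun z => Real.le_sqrt_of_sq_le ?_
    exact (hz z).symm.trans_le (norm_character_le z _)

variable [PartialOrder A] [StarOrderedRing A]

noncomputable instance : CStarModule A F.toSubmodule where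
  inner_add_right {ξ η ζ} := character_ext fun z => by
    simp only [map_add, character_inner, Submodule.coe_add, BoundedField.add_apply,
      inner_add_right]
  inner_self_nonneg {ξ} := nonneg_of_character_nonneg fun z => by
    rw [character_inner, inner_self_eq_norm_sq_to_K]
    exact pow_nonneg (Complex.zero_le_real.2 (norm_nonneg (ξ.1 z))) 2
  inner_self {ξ} := by
    rw [← norm_eq_zero, norm_inner_self, sq_eq_zero_iff, norm_eq_zero]
  inner_op_smul_right {a ξ η} := character_ext fun z => by
    simp only [map_mul, character_inner, Submodule.coe_smul, BoundedField.smul_apply,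
      inner_smul_right]
  inner_smul_right_complex {c ξ η} := character_ext fun z => by
    simp only [map_smul, character_inner, Submodule.coe_smul_of_tower,
      BoundedField.complex_smul_apply, inner_smul_right, smul_eq_mul]
  star_inner ξ η := character_ext fun z => by
    rw [map_star, character_inner, character_inner, RCLike.star_def, inner_conj_symm]
  norm_eq_sqrt_norm_inner_self ξ := by
    rw [norm_inner_self, Real.sqrt_sq (norm_nonneg ξ)]

end Sections

section Generation

/-- The bounded fields whose pointwise inner product with `ξ` is continuous. -/
def innerContinuous (ξ : BoundedField A H) : Submodule A (BoundedField A H) where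
  carrier := {η | Continuous fun z => ⟪ξ z, η z⟫_ℂ}
  zero_mem' := continuous_const.congr fun z => (inner_zero_right (ξ z)).symm
  add_mem' hη hζ := (hη.add hζ).congr fun z => (inner_add_right (ξ z) _ _).symm
  smul_mem' a _ hη := ((gelfandStarTransform A a).continuous.mul hη).congr fun z =>
    (inner_smul_right (ξ z) _ (z a)).symm

theorem mem_innerContinuous_comm {ξ η : BoundedField A H} :
    η ∈ innerContinuous ξ ↔ ξ ∈ innerContinuous η := by
  suffices ∀ ξ η : BoundedField A H, η ∈ innerContinuous ξ → ξ ∈ innerContinuous η from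
    ⟨this ξ η, this η ξ⟩
  intro ξ η h
  exact (Complex.continuous_conj.comp h).congr fun z => inner_conj_symm (η z) (ξ z)

theorem isClosed_innerContinuous (ξ : BoundedField A H) :
    IsClosed (innerContinuous ξ : Set (BoundedField A H)) := by
  refine isClosed_of_closure_subset fun η hη => ?_
  refine continuous_of_uniform_approx_of_continuous fun U hU => ?_
  obtain ⟨ε, hε, hεU⟩ := Metric.mem_uniformity_dist.1 hU
  obtain ⟨ζ, hζ, hdist⟩ := Metric.mem_closure_iff.1 hη (ε / (‖ξ‖ + 1)) (by positivity)
  refine ⟨_, hζ, fun z => hεU ?_⟩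
  calc dist ⟪ξ z, η z⟫_ℂ ⟪ξ z, ζ z⟫_ℂ = ‖⟪ξ z, (η - ζ) z⟫_ℂ‖ := by
        rw [dist_eq_norm, BoundedField.sub_apply, inner_sub_right]
    _ ≤ ‖ξ z‖ * ‖(η - ζ) z‖ := norm_inner_le_norm _ _
    _ ≤ ‖ξ‖ * dist η ζ := by
        rw [dist_eq_norm]
        gcongr <;> exact BoundedField.norm_apply_le _ z
    _ ≤ (‖ξ‖ + 1) * dist η ζ := by gcongr; exact le_add_of_nonneg_right zero_le_one
    _ < ε := by rwa [lt_div_iff₀' (by positivity)] at hdist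

variable {ι : Type*} {v : ι → BoundedField A H}

/-- The continuous field of Hilbert spaces generated by bounded sections with continuous pointwise
inner products. -/
noncomputable def generatedBy (v : ι → BoundedField A H)
    (hv : ∀ i j, Continuous fun z => ⟪v i z, v j z⟫_ℂ) : ContinuousField A H where
  toSubmodule := (Submodule.span A (Set.range v)).topologicalClosure
  isClosed := Submodule.isClosed_topologicalClosure _
  continuous_inner ξ hξ _ := by
    have h (i : ι) : v i ∈ innerContinuous ξ := mem_innerContinuous_comm.1 <|
      topologicalClosure_span_range_le (isClosed_innerContinuous (v i)) (hv i) hξ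
    exact fun hη => topologicalClosure_span_range_le (isClosed_innerContinuous ξ) h hη

variable (hv : ∀ i j, Continuous fun z => ⟪v i z, v j z⟫_ℂ)

theorem mem_generatedBy (i : ι) : v i ∈ (generatedBy v hv).toSubmodule :=
  Submodule.le_topologicalClosure _ (Submodule.subset_span ⟨i, rfl⟩)

theorem apply_mem_of_mem_generatedBy {z : characterSpace ℂ A} {K : Submodule ℂ H}
    (hK : IsClosed (K : Set H)) (h : ∀ i, v i z ∈ K) (ξ : (generatedBy v hv).toSubmodule) :
    ξ.1 z ∈ K := by
  let N : Submodule A (BoundedField A H) :=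
    { carrier := {ξ | ξ z ∈ K}
      zero_mem' := K.zero_mem
      add_mem' := K.add_mem
      smul_mem' := fun a _ => K.smul_mem (z a) }
  have hN : IsClosed (N : Set (BoundedField A H)) := hK.preimage (BoundedField.continuous_eval z)
  exact topologicalClosure_span_range_le hN h ξ.2

end Generation

end ContinuousField

section Topology

variable {Z : Type*} [TopologicalSpace Z] [CompactSpace Z]

variable (Z) in
/-- The function is a sum `∑ 2⁻ⁿ gₙ` of bumps at `u n` with disjoint supports. -/
theorem exists_continuous_apply_eq_half_pow [T2Space Z] [Infinite Z] :
    ∃ (f : C(Z, ℝ)) (u : ℕ → Z), ∀ n, f (u n) = (1 / 2) ^ n := by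
  obtain ⟨U, hU_inf, hU_open, hU_disj⟩ := exists_seq_infinite_isOpen_pairwise_disjoint Z
  choose u hu using fun n => (hU_inf n).nonempty
  have exists_bump (n : ℕ) : ∃ g : C(Z, ℝ), Set.EqOn g 0 (U n)ᶜ ∧ Set.EqOn g 1 {u n} ∧
      ∀ z, g z ∈ Set.Icc (0 : ℝ) 1 :=
    exists_continuous_zero_one_of_isClosed (hU_open n).isClosed_compl isClosed_singleton
      (Set.disjoint_singleton_right.2 fun h => h (hu n))
  choose g hg_zero hg_one hg using exists_bump
  have hg_le (n : ℕ) (z : Z) : ‖(1 / 2 : ℝ) ^ n * g n z‖ ≤ (1 / 2 : ℝ) ^ n := by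
    rw [Real.norm_of_nonneg (mul_nonneg (by positivity) (hg n z).1)]
    exact mul_le_of_le_one_right (by positivity) (hg n z).2
  let f : C(Z, ℝ) := ⟨fun z => ∑' n, (1 / 2 : ℝ) ^ n * g n z,
    continuous_tsum (fun n => by fun_prop) summable_geometric_two hg_le⟩
  refine ⟨f, u, fun n => ?_⟩
  change ∑' m, (1 / 2 : ℝ) ^ m * g m (u n) = _
  rw [tsum_eq_single n, hg_one n rfl, Pi.one_apply, mul_one]
  intro m hm
  rw [hg_zero m fun h => Set.disjoint_left.1 (hU_disj hm) h (hu n), Pi.zero_apply, mul_zero]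

theorem exists_eq_mem_closure_range_of_tendsto {Y : Type*} [TopologicalSpace Y] [T2Space Y]
    {f : Z → Y} (hf : Continuous f) {u : ℕ → Z} {y : Y} (h : Tendsto (f ∘ u) atTop (𝓝 y)) :
    ∃ z, f z = y ∧ z ∈ closure (Set.range u) := by
  obtain ⟨z, hz⟩ : ∃ z, MapClusterPt z atTop u := exists_clusterPt_of_compactSpace (map u atTop)
  have hfz : ClusterPt (f z) (𝓝 y) := (hz.continuousAt_comp hf.continuousAt).clusterPt.mono h
  refine ⟨z, eq_of_nhds_neBot hfz, mem_closure_iff_nhds.2 fun t ht => ?_⟩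
  obtain ⟨n, hn⟩ := (hz.frequently ht).exists
  exact ⟨u n, hn, n, rfl⟩

variable (Z) in
theorem exists_continuous_eq_zero_mem_closure_range [T2Space Z] [Infinite Z] :
    ∃ (f : C(Z, ℝ)) (u : ℕ → Z) (z : Z), (∀ n, 0 < f (u n)) ∧ f z = 0 ∧
      z ∈ closure (Set.range u) := by
  obtain ⟨f, u, hu⟩ := exists_continuous_apply_eq_half_pow Z
  have hlim : Tendsto (f ∘ u) atTop (𝓝 0) :=
    (tendsto_pow_atTop_nhds_zero_of_lt_one (by norm_num) (by norm_num)).congr fun n => (hu n).symm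
  obtain ⟨z, hz, hzu⟩ := exists_eq_mem_closure_range_of_tendsto f.continuous hlim
  exact ⟨f, u, z, fun n => hu n ▸ by positivity, hz, hzu⟩

end Topology

section Boxes

open MeasureTheory

/-- The Hilbert space `L²(ℝ) ⊕ ℓ²(ℝ)`, in which the fibers of `boxField` lie. -/
abbrev BoxSpace : Type := WithLp 2 (Lp ℂ 2 (volume : Measure ℝ) × lp (fun _ : ℝ => ℂ) 2)

/-- The normalized indicator function of `[s, s + t]` in `L²(ℝ)`, replaced for `t ≤ 0` by the
standard basis vector of `ℓ²(ℝ)` at `s`. The inner products depend continuously on `t`, although for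
`t > 0` the vectors span a separable space and at `t = 0` they are an uncountable orthonormal
family. -/
noncomputable def boxVector (t s : ℝ) : BoxSpace :=
  if 0 < t then
    WithLp.toLp 2 (((√t)⁻¹ : ℂ) •
      indicatorConstLp 2 (measurableSet_Icc (a := s) (b := s + t)) measure_Icc_lt_top.ne 1, 0)
  else WithLp.toLp 2 (0, lp.single 2 s 1)

/-- The inner product of `boxVector t s` and `boxVector t (s + d)`, where `d ≠ 0`. -/
noncomputable def boxOverlap (d t : ℝ) : ℝ := max 0 (t - |d|) / max t |d|

theorem continuous_boxOverlap {d : ℝ} (hd : d ≠ 0) : Continuous (boxOverlap d) :=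
  Continuous.div (by fun_prop) (by fun_prop) fun t =>
    (lt_max_of_lt_right (abs_pos.2 hd)).ne'

theorem boxOverlap_of_nonpos {t : ℝ} (ht : t ≤ 0) (d : ℝ) : boxOverlap d t = 0 := by
  rw [boxOverlap, max_eq_left (by linarith [abs_nonneg d]), zero_div]

theorem boxOverlap_eq_div (d t : ℝ) : boxOverlap d t = max 0 (t - |d|) / t := by
  rcases le_total |d| t with h | h
  · rw [boxOverlap, max_eq_left h]
  · rw [boxOverlap, max_eq_left (sub_nonpos.2 h), zero_div, zero_div]

theorem volume_real_Icc_inter_Icc (r s t : ℝ) :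
    volume.real (Set.Icc r (r + t) ∩ Set.Icc s (s + t)) = max 0 (t - |r - s|) := by
  rw [Set.Icc_inter_Icc, Real.volume_real_Icc, max_comm, min_add_add_right,
    ← max_sub_min_eq_abs' r s]
  congr 1
  ring

theorem inner_boxVector (t r s : ℝ) :
    ⟪boxVector t r, boxVector t s⟫_ℂ = if r = s then 1 else (boxOverlap (r - s) t : ℂ) := by
  rcases le_or_gt t 0 with ht | ht
  · rw [boxOverlap_of_nonpos ht, boxVector, if_neg ht.not_gt, boxVector, if_neg ht.not_gt]
    simp [WithLp.prod_inner_apply, lp.inner_single_left, Pi.single_apply]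
  · have h : ⟪boxVector t r, boxVector t s⟫_ℂ = (max 0 (t - |r - s|) / t : ℝ) := by
      have hsqrt : (√t : ℂ) * √t = t := by rw [← Complex.ofReal_mul, Real.mul_self_sqrt ht.le]
      rw [boxVector, if_pos ht, boxVector, if_pos ht, WithLp.prod_inner_apply, inner_zero_left,
        add_zero, inner_smul_left, inner_smul_right,
        L2.inner_indicatorConstLp_one_indicatorConstLp_one _ _ measure_Icc_lt_top.ne
          measure_Icc_lt_top.ne, volume_real_Icc_inter_Icc, map_inv₀, Complex.conj_ofReal,
        ← mul_assoc, ← mul_inv, hsqrt, Complex.ofReal_div, div_eq_inv_mul]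
      rfl
    rw [h, boxOverlap_eq_div]
    split_ifs with hrs
    · rw [hrs, sub_self, abs_zero, sub_zero, max_eq_right ht.le, div_self ht.ne',
        Complex.ofReal_one]
    · rfl

theorem norm_boxVector (t s : ℝ) : ‖boxVector t s‖ = 1 := by
  rw [@norm_eq_sqrt_re_inner ℂ, inner_boxVector, if_pos rfl, RCLike.one_re, Real.sqrt_one]

theorem orthonormal_boxVector {t : ℝ} (ht : t ≤ 0) : Orthonormal ℂ (boxVector t) := by
  classical
  refine orthonormal_iff_ite.2 fun r s => ?_
  rw [inner_boxVector, boxOverlap_of_nonpos ht, Complex.ofReal_zero]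

end Boxes

section BoxField

variable {A : Type*} [CommCStarAlgebra A] (f : C(characterSpace ℂ A, ℝ))

/-- The bounded field `w ↦ boxVector (f w) s`, a generator of `boxField f`. -/
noncomputable def boxSection (s : ℝ) : BoundedField A BoxSpace :=
  ⟨fun w => boxVector (f w) s,
    memℓp_infty ⟨1, Set.forall_mem_range.2 fun w => (norm_boxVector (f w) s).le⟩⟩

theorem boxSection_apply (s : ℝ) (w : characterSpace ℂ A) :
    boxSection f s w = boxVector (f w) s := rfl

theorem continuous_inner_boxSection (r s : ℝ) :
    Continuous fun w => ⟪boxSection f r w, boxSection f s w⟫_ℂ := by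
  simp only [boxSection_apply, inner_boxVector]
  split_ifs with h
  · exact continuous_const
  · exact Complex.continuous_ofReal.comp
      ((continuous_boxOverlap (sub_ne_zero.2 h)).comp f.continuous)

/-- The continuous field generated by the sections `boxSection f s`. Its fiber is separable where
`f > 0` and nonseparable elsewhere, so its module of sections has no frame for suitable `f`. -/
noncomputable def boxField : ContinuousField A BoxSpace :=
  .generatedBy (boxSection f) (continuous_inner_boxSection f)

theorem isSeparable_range_boxField {w : characterSpace ℂ A} (hw : 0 < f w) :
    TopologicalSpace.IsSeparable (Set.range fun ξ : (boxField f).toSubmodule => ξ.1 w) := by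
  let K : Submodule ℂ BoxSpace := (WithLp.sndL 2 ℂ _ _ : BoxSpace →L[ℂ] lp (fun _ : ℝ => ℂ) 2).ker
  have hK : IsClosed (K : Set BoxSpace) := ContinuousLinearMap.isClosed_ker _
  have hmem (s : ℝ) : boxSection f s w ∈ K := by
    rw [boxSection_apply, boxVector, if_pos hw]
    rfl
  have : Fact ((2 : ℝ≥0∞) ≠ ∞) := ⟨ENNReal.ofNat_ne_top⟩
  have hsep : TopologicalSpace.IsSeparable
      (Set.range fun g => (WithLp.toLp 2 (g, 0) : BoxSpace)) :=
    TopologicalSpace.isSeparable_range (by fun_prop)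
  refine hsep.mono (Set.range_subset_iff.2 fun ξ => ⟨(ξ.1 w).fst, ?_⟩)
  have hξ : (ξ.1 w).snd = 0 := ContinuousField.apply_mem_of_mem_generatedBy _ hK hmem ξ
  exact WithLp.ofLp_injective 2 (Prod.ext rfl hξ.symm)

end BoxField

theorem countable_setOf_apply_ne_zero {J E : Type*} [NormedAddCommGroup E]
    [InnerProductSpace ℂ E] {x : J → E} {S : Set E} (hS : TopologicalSpace.IsSeparable S)
    (hx : ∀ j, x j ∈ S) (h : ∀ v ∈ S, {j | ⟪x j, v⟫_ℂ ≠ 0}.Countable) :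
    {j | x j ≠ 0}.Countable := by
  obtain ⟨D, hDS, hD, hSD⟩ := hS.exists_countable_dense_subset
  refine (hD.biUnion fun v hv => h v (hDS hv)).mono fun j hj => ?_
  by_contra hjD
  simp only [Set.mem_iUnion, Set.mem_ofPred_eq, not_exists, not_not] at hjD
  have hclosed : IsClosed {v | ⟪x j, v⟫_ℂ = 0} :=
    isClosed_eq (continuous_const.inner continuous_id) continuous_const
  exact hj (inner_self_eq_zero.1 (closure_minimal hjD hclosed (hSD (hx j))))

theorem countable_of_orthonormal_of_exists_inner_ne_zero {J ι E : Type*}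
    [NormedAddCommGroup E] [InnerProductSpace ℂ E] {v : ι → E} (hv : Orthonormal ℂ v) {x : J → E}
    (hx : {j | x j ≠ 0}.Countable) (h : ∀ i, ∃ j, ⟪x j, v i⟫_ℂ ≠ 0) : Countable ι := by
  have hsupp (j : J) : {i | ⟪x j, v i⟫_ℂ ≠ 0}.Countable := by
    refine (hv.inner_products_summable (x j)).countable_support.mono fun i hi => ?_
    rw [Function.mem_support]
    exact pow_ne_zero 2 (norm_ne_zero_iff.2 fun h0 => hi (inner_eq_zero_symm.1 h0))
  refine Set.countable_univ_iff.1 ((hx.biUnion fun j _ => hsupp j).mono fun i _ => ?_)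
  obtain ⟨j, hj⟩ := h i
  exact Set.mem_biUnion (x := j) (fun h0 => hj (by rw [h0, inner_zero_left])) hj

namespace ContinuousField

variable {A : Type u} {H : Type*} [CommCStarAlgebra A] [PartialOrder A] [StarOrderedRing A]
  [NormedAddCommGroup H] [InnerProductSpace ℂ H] {F : ContinuousField A H} {J : Type*}
  {x : J → F.toSubmodule}

theorem countable_setOf_inner_apply_ne_zero (hx : IsFrame A x) (z : characterSpace ℂ A)
    (ξ : F.toSubmodule) : {j | ⟪(x j).1 z, ξ.1 z⟫_ℂ ≠ 0}.Countable := by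
  obtain ⟨C, -, h⟩ := hx.exists_character_lower_bound
  refine (h z ξ).1.countable_support.mono fun j hj => ?_
  rw [Function.mem_support, character_inner]
  exact pow_ne_zero 2 (norm_ne_zero_iff.2 hj)

theorem exists_inner_apply_ne_zero (hx : IsFrame A x) {z : characterSpace ℂ A}
    {ξ : F.toSubmodule} (hξ : ξ.1 z ≠ 0) : ∃ j, ⟪(x j).1 z, ξ.1 z⟫_ℂ ≠ 0 := by
  obtain ⟨C, hC, h⟩ := hx.exists_character_lower_bound
  by_contra! hzero
  have hle := (h z ξ).2
  simp only [character_inner, hzero, norm_zero, ne_eq, OfNat.ofNat_ne_zero, not_false_eq_true,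
    zero_pow, tsum_zero] at hle
  have hpos : 0 < (⟪ξ.1 z, ξ.1 z⟫_ℂ).re := RCLike.re_to_complex ▸ re_inner_self_pos.2 hξ
  exact (mul_pos hC hpos).not_ge hle

theorem countable_setOf_apply_ne_zero_of_isFrame (hx : IsFrame A x) {z : characterSpace ℂ A}
    (hz : TopologicalSpace.IsSeparable (Set.range fun ξ : F.toSubmodule => ξ.1 z)) :
    {j | (x j).1 z ≠ 0}.Countable :=
  countable_setOf_apply_ne_zero hz (fun j => ⟨x j, rfl⟩) <|
    Set.forall_mem_range.2 (countable_setOf_inner_apply_ne_zero hx z)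

theorem not_isFrame_of_mem_closure {S : Set (characterSpace ℂ A)} (hS : S.Countable)
    (hsep : ∀ w ∈ S, TopologicalSpace.IsSeparable (Set.range fun ξ : F.toSubmodule => ξ.1 w))
    {z : characterSpace ℂ A} (hz : z ∈ closure S) {ι : Type*} [Uncountable ι]
    {v : ι → F.toSubmodule} (hv : Orthonormal ℂ fun i => (v i).1 z) (x : J → F.toSubmodule) :
    ¬ IsFrame A x := by
  intro hx
  have hcount : {j | (x j).1 z ≠ 0}.Countable := by
    refine (hS.biUnion fun w hw =>
      countable_setOf_apply_ne_zero_of_isFrame hx (hsep w hw)).mono fun j hj => ?_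
    by_contra hjS
    simp only [Set.mem_iUnion, Set.mem_ofPred_eq, not_exists, not_not] at hjS
    exact hj (apply_eq_zero_of_mem_closure (x j) hjS hz)
  exact not_countable (countable_of_orthonormal_of_exists_inner_ne_zero hv hcount fun i =>
    exists_inner_apply_ne_zero hx (hv.ne_zero i))

end ContinuousField

theorem exists_cstarModule_forall_not_isFrame (A : Type u) [CommCStarAlgebra A] [PartialOrder A]
    [StarOrderedRing A] (hA : ¬ FiniteDimensional ℂ A) :
    ∃ (X : Type u) (_ : NormedAddCommGroup X) (_ : NormedSpace ℂ X) (_ : Module A X)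
      (_ : CStarModule A X) (_ : CompleteSpace X),
      ∀ (J : Type u) (x : J → X), ¬ IsFrame A x := by
  have : Infinite (characterSpace ℂ A) :=
    not_finite_iff_infinite.1 fun _ => hA (finiteDimensional_of_finite_characterSpace A)
  obtain ⟨f, u, z, hu, hz, hzu⟩ :=
    exists_continuous_eq_zero_mem_closure_range (characterSpace ℂ A)
  let v (s : ℝ) : (boxField f).toSubmodule :=
    ⟨boxSection f s, ContinuousField.mem_generatedBy _ s⟩
  have hv : Orthonormal ℂ fun s => (v s).1 z := orthonormal_boxVector hz.le
  exact ⟨(boxField f).toSubmodule, inferInstance, inferInstance, inferInstance, inferInstance,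
    inferInstance, fun J => ContinuousField.not_isFrame_of_mem_closure (Set.countable_range u)
      (Set.forall_mem_range.2 fun n => isSeparable_range_boxField f (hu n)) hzu hv⟩

theorem theorem1p1 (A : Type u) [CommCStarAlgebra A] [PartialOrder A] [StarOrderedRing A] :
    List.TFAE [
      FiniteDimensional ℂ A,
      ∀ (X : Type u) [NormedAddCommGroup X] [NormedSpace ℂ X] [Module A X] [CStarModule A X]
        [CompleteSpace X],
        ∃ J : Type u,
          HilbertModuleIso A C⋆ᵐᵒᵈ(A, X × StandardModule A J) (StandardModule A J),
      ∀ (X : Type u) [NormedAddCommGroup X] [NormedSpace ℂ X] [Module A X] [CStarModule A X]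
        [CompleteSpace X],
        ∃ (J : Type u) (Y : Type u) (_ : NormedAddCommGroup Y) (_ : NormedSpace ℂ Y)
          (_ : Module A Y) (_ : CStarModule A Y) (_ : CompleteSpace Y),
          HilbertModuleIso A C⋆ᵐᵒᵈ(A, X × Y) (StandardModule A J),
      ∀ (X : Type u) [NormedAddCommGroup X] [NormedSpace ℂ X] [Module A X] [CStarModule A X]
        [CompleteSpace X],
        ∃ (J : Type u) (x : J → X), IsStandardFrame A x,
      ∀ (X : Type u) [NormedAddCommGroup X] [NormedSpace ℂ X] [Module A X] [CStarModule A X]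
        [CompleteSpace X],
        ∃ (J : Type u) (x : J → X), IsFrame A x] ∧
    (¬ FiniteDimensional ℂ A →
      ∃ (X : Type u) (_ : NormedAddCommGroup X) (_ : NormedSpace ℂ X) (_ : Module A X)
        (_ : CStarModule A X) (_ : CompleteSpace X),
        (¬ ∃ (J : Type u) (x : J → X), IsFrame A x) ∧
        ¬ ∃ J : Type u,
          HilbertModuleIso A C⋆ᵐᵒᵈ(A, X × StandardModule A J) (StandardModule A J)) := by
  refine ⟨?_, fun hA => ?_⟩
  · tfae_have 1 → 2 := fun _ X _ _ _ _ _ => exists_hilbertModuleIso_prod_standardModule X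
    tfae_have 2 → 3 := by
      intro h X _ _ _ _ _
      exact (h X).imp fun J hJ => ⟨StandardModule A J, inferInstance, inferInstance,
        inferInstance, inferInstance, inferInstance, hJ⟩
    tfae_have 3 → 4 := by
      intro h X _ _ _ _ _
      obtain ⟨J, Y, _, _, _, _, _, hJ⟩ := h X
      exact ⟨J, hJ.exists_isStandardFrame⟩
    tfae_have 4 → 5 := fun h X _ _ _ _ _ => (h X).imp fun _ ⟨x, hx⟩ => ⟨x, hx.1⟩
    tfae_have 5 → 1 := by
      intro h
      by_contra hA
      obtain ⟨X, _, _, _, _, _, hX⟩ := exists_cstarModule_forall_not_isFrame A hA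
      exact (h X).elim fun J ⟨x, hx⟩ => hX J x hx
    tfae_finish
  · obtain ⟨X, i₁, i₂, i₃, i₄, i₅, hX⟩ := exists_cstarModule_forall_not_isFrame A hA
    refine ⟨X, i₁, i₂, i₃, i₄, i₅, fun ⟨J, x, hx⟩ => hX J x hx, fun ⟨J, hJ⟩ => ?_⟩
    obtain ⟨x, hx⟩ := hJ.exists_isStandardFrame
    exact hX J x hx.1
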